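/- Let $(g_n)_{n\ge 1} = (1, 1, 3, 17, 155, 2073, \ldots)$ denote the (unsigned) Genocchi numbers, given by $$\frac{2t}{e^t+1} = t+\sum_{n\ge 1}(-1)^n g_n\frac{t^{2n}}{(2n)!}.$$ A cycle on $[N]=\{1,\ldots,N\}$ is an equivalence class of permutations (words) $\pi=\pi_1\pi_2\cdots\pi_N$ of $[N]$ under cyclic rotation. With indices read modulo $N$, a drop of the cycle $[\pi]$ is a pair $(\pi_i,\pi_{i+1})$, $1\le i\le N$, such that $\pi_i>\pi_{i+1}$; a drop $(\pi_i,\pi_{i+1})$ is called even-odd if $\pi_i$ is even and $\pi_{i+1}$ is odd. For every $n\ge 1$, the $n$-th Genocchi number $g_n$ is equal to the number of cycles on $[2n]$ all of whose drops are even-odd. -/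

import Mathlib

/-- The (unsigned) Genocchi numbers `g₁, g₂, g₃, … = 1, 1, 3, 17, 155, 2073, …`, given by
`2t / (eᵗ + 1) = t + ∑_{n ≥ 1} (-1)ⁿ gₙ t²ⁿ / (2n)!`. -/
noncomputable def genocchi (n : ℕ) : ℚ :=
  (-1) ^ n * (Nat.factorial (2 * n) : ℚ) *
    PowerSeries.coeff (2 * n) (2 * PowerSeries.X * (PowerSeries.exp ℚ + 1)⁻¹ : PowerSeries ℚ)

/-- The cycles on `{1, …, N}`: words in which each of `1, …, N` occurs exactly once (and nothing
else occurs), up to rotation. -/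
def CycleOn (N : ℕ) : Type :=
  {c : Cycle ℕ // c.Nodup ∧ ∀ k : ℕ, k ∈ c ↔ 1 ≤ k ∧ k ≤ N}

/-- The set of drops of a cycle: the pairs `(a, b)` such that `b` follows `a` cyclically
and `a > b`. -/
def CycleOn.drops {N : ℕ} (c : CycleOn N) : Set (ℕ × ℕ) :=
  {p | ∃ h : p.1 ∈ c.val, c.val.next c.property.1 p.1 h = p.2 ∧ p.1 > p.2}

/-- All drops `(a, b)` of the cycle are even-odd: `a` is even and `b` is odd. -/
def CycleOn.OnlyEvenOddDrops {N : ℕ} (c : CycleOn N) : Prop :=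
  ∀ p ∈ c.drops, Even p.1 ∧ Odd p.2

/-! Both sides equal the value at 1 of the same Gandhi polynomial.

Arithmetic side: let L send `X ^ m` to `m!` times the `t ^ m` coefficient of `2t / (eᵗ + 1)`.
Multiplying by `eᵗ + 1` gives L(p(X + 1) + p(X)) = 2p'(0). This evaluates L on X·Q_k, where Q_k is
the odd central factorial, and X²·Q_k = Q_{k+1} + (k + 1)²·Q_k becomes the Gandhi recurrence
(`genocchiFunctional_eq_gandhi`).

Combinatorial side: cutting a cycle at its largest letter 2n leaves one even-odd word on 1, …, 2n -
1 (`closeUp_bijective`). Count families of y such words by removing the largest letter. An odd one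
ends its word, giving a factor y; an even one splits its word in two, the first part nonempty,
giving y times a difference in y (`appendOdd_bijective`, `joinEven_bijective`). Two removals give
the Gandhi recurrence. -/

/-! ### Umbral calculus for the Genocchi numbers -/

open Polynomial in
/-- The linear functional on polynomials sending `X ^ m` to the `m`-th coefficient of the
exponential generating function `2t / (eᵗ + 1)`. -/
noncomputable def genocchiFunctional : ℚ[X] →ₗ[ℚ] ℚ :=
  Polynomial.lsum fun m => LinearMap.mulRight ℚ ((Nat.factorial m : ℚ) *
    PowerSeries.coeff m (2 * PowerSeries.X * (PowerSeries.exp ℚ + 1)⁻¹ : PowerSeries ℚ))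

theorem genocchiFunctional_X_pow (m : ℕ) :
    genocchiFunctional (Polynomial.X ^ m) = (Nat.factorial m : ℚ) *
      PowerSeries.coeff m (2 * PowerSeries.X * (PowerSeries.exp ℚ + 1)⁻¹ : PowerSeries ℚ) := by
  simp [genocchiFunctional, Polynomial.lsum_apply, ← Polynomial.monomial_one_right_eq_X_pow,
    Polynomial.sum_monomial_index]

theorem genocchiFunctional_X_add_one_pow (m : ℕ) :
    genocchiFunctional ((Polynomial.X + 1) ^ m) + genocchiFunctional (Polynomial.X ^ m) =
      if m = 1 then 2 else 0 := by
  have key : (PowerSeries.exp ℚ + 1) *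
      (2 * PowerSeries.X * (PowerSeries.exp ℚ + 1)⁻¹ : PowerSeries ℚ) = 2 * PowerSeries.X := by
    have h : (PowerSeries.exp ℚ + 1) * (PowerSeries.exp ℚ + 1)⁻¹ = 1 :=
      PowerSeries.mul_inv_cancel _ (by simp)
    linear_combination (2 * PowerSeries.X) * h
  rw [add_pow, map_sum, genocchiFunctional_X_pow]
  have hterm : ∀ j ∈ Finset.range (m + 1),
      genocchiFunctional (Polynomial.X ^ j * 1 ^ (m - j) * ((m.choose j : ℕ) : Polynomial ℚ)) =
      (m.factorial : ℚ) * (PowerSeries.coeff j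
        (2 * PowerSeries.X * (PowerSeries.exp ℚ + 1)⁻¹ : PowerSeries ℚ) *
          PowerSeries.coeff (m - j) (PowerSeries.exp ℚ)) := by
    intro j hj
    have hj' : j ≤ m := Nat.lt_succ_iff.mp (Finset.mem_range.mp hj)
    have : (Polynomial.X ^ j * 1 ^ (m - j) * ((m.choose j : ℕ) : Polynomial ℚ)) =
        (m.choose j : ℚ) • Polynomial.X ^ j := by
      rw [one_pow, mul_one, Polynomial.smul_eq_C_mul, mul_comm]; simp
    rw [this, map_smul, genocchiFunctional_X_pow, PowerSeries.coeff_exp,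
      Nat.cast_choose ℚ hj', smul_eq_mul]
    have h1 : (j.factorial : ℚ) ≠ 0 := by positivity
    have h2 : ((m - j).factorial : ℚ) ≠ 0 := by positivity
    simp
    field_simp
  rw [Finset.sum_congr rfl hterm, ← Finset.mul_sum,
    ← Finset.Nat.sum_antidiagonal_eq_sum_range_succ_mk (f := fun p =>
      PowerSeries.coeff p.1 (2 * PowerSeries.X * (PowerSeries.exp ℚ + 1)⁻¹ : PowerSeries ℚ) *
          PowerSeries.coeff p.2 (PowerSeries.exp ℚ)), ← PowerSeries.coeff_mul, ← mul_add, ← map_add,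
    show ∀ F : PowerSeries ℚ, F * PowerSeries.exp ℚ + F = (PowerSeries.exp ℚ + 1) * F by
      intro F; ring, key,
    show (2 * PowerSeries.X : PowerSeries ℚ) = (2 : ℚ) • PowerSeries.X by
      rw [PowerSeries.smul_eq_C_mul, map_ofNat], PowerSeries.coeff_smul, PowerSeries.coeff_X]
  split_ifs with h <;> simp [h]

/-- Linear extension of the monomial case; only the linear coefficient of `p` contributes. -/
theorem genocchiFunctional_comp_X_add_one (p : Polynomial ℚ) :
    genocchiFunctional (p.comp (Polynomial.X + 1)) + genocchiFunctional p =
      2 * p.derivative.eval 0 := by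
  induction p using Polynomial.induction_on' with
  | add p q hp hq =>
    simp only [Polynomial.add_comp, map_add, Polynomial.eval_add]
    linear_combination hp + hq
  | monomial m c =>
    rw [← Polynomial.smul_X_eq_monomial, Polynomial.smul_comp, map_smul, map_smul,
      Polynomial.X_pow_comp, ← smul_add, genocchiFunctional_X_add_one_pow]
    rcases m with _ | _ | m <;> simp
    ring

/-! ### Central factorials and the Gandhi recurrence -/

/-- The odd central factorial polynomial `X ∏_{0 < i ≤ k} (X² - i²)`. -/
noncomputable def oddCentralFactorial (k : ℕ) : Polynomial ℚ :=
  Polynomial.X * ∏ i ∈ Finset.range k, (Polynomial.X ^ 2 - ((i : Polynomial ℚ) + 1) ^ 2)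

theorem oddCentralFactorial_succ (k : ℕ) :
    oddCentralFactorial (k + 1) =
      oddCentralFactorial k * (Polynomial.X ^ 2 - ((k : Polynomial ℚ) + 1) ^ 2) := by
  rw [oddCentralFactorial, Finset.prod_range_succ, oddCentralFactorial, mul_assoc]

/-- The polynomial is the product (X + k)(X + k - 1)⋯(X - k), so a shift by 1 trades the factor X -
k for X + k + 1. -/
theorem oddCentralFactorial_comp (k : ℕ) :
    (oddCentralFactorial k).comp (Polynomial.X + 1) * (Polynomial.X - (k : Polynomial ℚ)) =
      oddCentralFactorial k * (Polynomial.X + (k : Polynomial ℚ) + 1) := by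
  induction k with
  | zero => simp [oddCentralFactorial]; ring
  | succ k ih =>
    rw [oddCentralFactorial_succ]
    simp only [Polynomial.mul_comp, Polynomial.sub_comp, Polynomial.pow_comp, Polynomial.X_comp,
      Polynomial.add_comp, Polynomial.natCast_comp, Polynomial.one_comp]
    push_cast
    linear_combination (Polynomial.X + (k : Polynomial ℚ) + 2) *
      (Polynomial.X - (k : Polynomial ℚ) - 1) * ih

theorem genocchiFunctional_X_mul_oddCentralFactorial (k : ℕ) :
    genocchiFunctional (Polynomial.X * oddCentralFactorial k) =
      (-1) ^ (k + 1) * (k.factorial : ℚ) ^ 2 * ((k : ℚ) + 1) := by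
  -- The factor X - (k + 1) shifts to X - k, so the two terms become Q_k·(X + k + 1) and Q_k·(X - k
  -- - 1), with sum 2X·Q_k.
  have h := genocchiFunctional_comp_X_add_one
    (oddCentralFactorial k * (Polynomial.X - ((k : Polynomial ℚ) + 1)))
  rw [← map_add] at h
  have e : (oddCentralFactorial k * (Polynomial.X - ((k : Polynomial ℚ) + 1))).comp
      (Polynomial.X + 1) + oddCentralFactorial k * (Polynomial.X - ((k : Polynomial ℚ) + 1)) =
      (2 : ℚ) • (Polynomial.X * oddCentralFactorial k) := by
    have := oddCentralFactorial_comp k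
    simp only [Polynomial.mul_comp, Polynomial.sub_comp, Polynomial.X_comp,
      Polynomial.add_comp, Polynomial.natCast_comp, Polynomial.one_comp]
    rw [Polynomial.smul_eq_C_mul, Polynomial.C_ofNat]
    linear_combination this
  have hprod : ∀ k : ℕ, ∏ i ∈ Finset.range k, (-((i : ℚ) + 1) ^ 2) =
      (-1) ^ k * (k.factorial : ℚ) ^ 2 := by
    intro k
    induction k with
    | zero => simp
    | succ k ih => rw [Finset.prod_range_succ, ih, Nat.factorial_succ]; push_cast; ring
  have d : (oddCentralFactorial k * (Polynomial.X - ((k : Polynomial ℚ) + 1))).derivative.eval 0 =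
      (-1) ^ (k + 1) * (k.factorial : ℚ) ^ 2 * ((k : ℚ) + 1) := by
    rw [oddCentralFactorial, mul_assoc, Polynomial.derivative_mul]
    simp [Polynomial.eval_prod]
    rw [hprod]; ring
  rw [e, map_smul, smul_eq_mul, d] at h
  linarith

/-- Values `P_{n+1}(y)` of the Gandhi polynomials: `P₁(y) = y`,
`P_{n+1}(y) = y² (P_n(y + 1) - P_n(y))`. -/
def gandhi : ℕ → ℕ → ℤ
  | 0, y => y
  | n + 1, y => (y : ℤ) ^ 2 * (gandhi n (y + 1) - gandhi n y)

/-- Induction for all `k` at once: trading X² for Q_{k+1} and Q_k moves the Gandhi argument to k + 2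
and k + 1. -/
theorem genocchiFunctional_eq_gandhi (m k : ℕ) :
    genocchiFunctional (Polynomial.X ^ (2 * m) * (Polynomial.X * oddCentralFactorial k)) =
      (-1) ^ (k + 1 + m) * (k.factorial : ℚ) ^ 2 * (gandhi m (k + 1) : ℚ) := by
  induction m generalizing k with
  | zero => simp [genocchiFunctional_X_mul_oddCentralFactorial, gandhi]
  | succ m ih =>
    have e : Polynomial.X ^ (2 * (m + 1)) * (Polynomial.X * oddCentralFactorial k) =
        Polynomial.X ^ (2 * m) * (Polynomial.X * oddCentralFactorial (k + 1)) +
        (((k : ℚ) + 1) ^ 2) •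
          (Polynomial.X ^ (2 * m) * (Polynomial.X * oddCentralFactorial k)) := by
      rw [oddCentralFactorial_succ, Polynomial.smul_eq_C_mul]
      simp only [map_pow, map_add, map_natCast, map_one]
      ring
    rw [e, map_add, map_smul, ih, ih, gandhi, Nat.factorial_succ, smul_eq_mul]
    push_cast
    ring

theorem genocchi_succ_eq_gandhi (n : ℕ) : genocchi (n + 1) = gandhi n 1 := by
  have h := genocchiFunctional_eq_gandhi n 0
  rw [show Polynomial.X ^ (2 * n) * (Polynomial.X * oddCentralFactorial 0) =
    Polynomial.X ^ (2 * (n + 1)) by simp [oddCentralFactorial]; ring,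
    genocchiFunctional_X_pow] at h
  rw [genocchi, mul_assoc, h]
  have : ((-1 : ℚ) ^ n) ^ 2 = 1 := by rw [← pow_mul, mul_comm, pow_mul]; simp
  simp [pow_add]
  linear_combination (gandhi n 1 : ℚ) * this

/-! ### Even-odd words and their largest letter -/

/-- The relation between consecutive letters: a drop must be even-odd. -/
def EvenOddStep (a b : ℕ) : Prop := a > b → Even a ∧ Odd b

theorem EvenOddStep.of_lt {a b : ℕ} (h : a < b) : EvenOddStep a b := fun h' => by omega

theorem EvenOddStep.of_even_odd {a b : ℕ} (ha : Even a) (hb : Odd b) : EvenOddStep a b :=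
  fun _ => ⟨ha, hb⟩

/-- Words whose drops are even-odd and which, if nonempty, start with an odd letter. -/
def IsEvenOddWord (l : List ℕ) : Prop := l.IsChain EvenOddStep ∧ ∀ a ∈ l.head?, Odd a

/-- The step into `M` is a rise and the step out is a drop, so `b` must be empty or start odd; `a`
is nonempty since `M` itself cannot come first. -/
theorem isEvenOddWord_append_cons_iff {a b : List ℕ} {M : ℕ} (hM : Even M)
    (ha : ∀ x ∈ a, x < M) (hb : ∀ x ∈ b, x < M) :
    IsEvenOddWord (a ++ M :: b) ↔ a ≠ [] ∧ IsEvenOddWord a ∧ IsEvenOddWord b := by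
  unfold IsEvenOddWord
  rw [List.isChain_append, List.isChain_cons]
  constructor
  · rintro ⟨⟨h1, ⟨h2, h3⟩, -⟩, h5⟩
    have hne : a ≠ [] := by
      rintro rfl
      have := h5 M (by simp)
      exact (Nat.not_odd_iff_even.mpr hM) this
    refine ⟨hne, ⟨h1, ?_⟩, h3, fun x hx => (h2 x hx (hb x (List.mem_of_mem_head? hx))).2⟩
    intro x hx
    apply h5
    cases a with
    | nil => simp at hx
    | cons y a => simpa using hx
  · rintro ⟨hne, ⟨h1, h2⟩, h3, h4⟩
    refine ⟨⟨h1, ⟨fun x hx => .of_even_odd hM (h4 x hx), h3⟩, ?_⟩, ?_⟩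
    · intro x hx y hy
      have : M = y := by simpa using hy
      exact .of_lt (this ▸ ha x (List.mem_of_mem_getLast? hx))
    · cases a with
      | nil => exact absurd rfl hne
      | cons y a => simpa using h2

/-- Any letter after the odd maximum would create a drop from an odd letter. -/
theorem isEvenOddWord_append_cons_iff_of_odd {a b : List ℕ} {M : ℕ} (hM : Odd M)
    (ha : ∀ x ∈ a, x < M) (hb : ∀ x ∈ b, x < M) :
    IsEvenOddWord (a ++ M :: b) ↔ b = [] ∧ IsEvenOddWord a := by
  unfold IsEvenOddWord
  rw [List.isChain_append, List.isChain_cons]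
  constructor
  · rintro ⟨⟨h1, ⟨h2, h3⟩, -⟩, h5⟩
    refine ⟨?_, h1, ?_⟩
    · cases b with
      | nil => rfl
      | cons y b =>
        have := h2 y (by simp) (hb y (by simp))
        exact absurd hM (Nat.not_odd_iff_even.mpr this.1)
    · intro x hx
      apply h5
      cases a with
      | nil => simp at hx
      | cons y a => simpa using hx
  · rintro ⟨rfl, h1, h2⟩
    refine ⟨⟨h1, ⟨by simp, by simp⟩, ?_⟩, ?_⟩
    · intro x hx y hy
      have : M = y := by simpa using hy
      exact .of_lt (this ▸ ha x (List.mem_of_mem_getLast? hx))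
    · cases a with
      | nil => simpa using hM
      | cons y a => simpa using h2

/-! ### Families of words and removal of the largest letter -/

/-- Families of even-odd words, indexed by `ι`, in which each of `1, …, m` occurs exactly once. -/
@[ext]
structure WordFamily (ι : Type) [Fintype ι] (m : ℕ) : Type where
  /-- The words of the family. -/
  word : ι → List ℕ
  isEvenOddWord : ∀ i, IsEvenOddWord (word i)
  sum_eq : ∑ i, (word i : Multiset ℕ) = (Finset.Icc 1 m).val

theorem Icc_val_succ (m : ℕ) :
    (Finset.Icc 1 (m + 1)).val = (m + 1) ::ₘ (Finset.Icc 1 m).val := by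
  rw [← Finset.insert_Icc_right_eq_Icc_add_one (by omega), Finset.insert_val_of_notMem (by simp)]

section families

variable {ι : Type} [Fintype ι]

/-- Stated additively because multisets have no well-behaved subtraction. -/
theorem add_sum_update [DecidableEq ι] (w : ι → List ℕ) (i : ι) (l : List ℕ) :
    (w i : Multiset ℕ) + ∑ j, (Function.update w i l j : Multiset ℕ) =
      l + ∑ j, (w j : Multiset ℕ) := by
  rw [← Finset.add_sum_erase _ _ (Finset.mem_univ i),
    ← Finset.add_sum_erase _ (fun j => (w j : Multiset ℕ)) (Finset.mem_univ i),
    Function.update_self, add_left_comm]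
  congr 2
  refine Finset.sum_congr rfl fun j hj => ?_
  rw [Function.update_of_ne (Finset.ne_of_mem_erase hj)]

theorem mem_le_of_sum_eq {w : ι → List ℕ} {m : ℕ}
    (h : ∑ i, (w i : Multiset ℕ) = (Finset.Icc 1 m).val) {i : ι} {x : ℕ} (hx : x ∈ w i) :
    x ≤ m := by
  have : x ∈ (Finset.Icc 1 m).val := by
    rw [← h]
    exact Multiset.mem_of_le (Finset.single_le_sum (f := fun i => (w i : Multiset ℕ))
      (fun _ _ => bot_le) (Finset.mem_univ i)) (by simpa using hx)
  exact (Finset.mem_Icc.mp (by simpa using this)).2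

theorem WordFamily.lt_succ {m : ℕ} (w : WordFamily ι m) {i : ι} {x : ℕ} (hx : x ∈ w.word i) :
    x < m + 1 :=
  Nat.lt_succ_of_le (mem_le_of_sum_eq w.sum_eq hx)

theorem WordFamily.exists_eq_append_cons [DecidableEq ι] {m : ℕ} (w : WordFamily ι (m + 1)) :
    ∃ i a b, w.word i = a ++ (m + 1) :: b ∧ (∀ x ∈ a, x < m + 1) ∧ (∀ x ∈ b, x < m + 1) ∧
      (a : Multiset ℕ) + b + ∑ j, (Function.update w.word i [] j : Multiset ℕ) =
        (Finset.Icc 1 m).val := by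
  have h := w.sum_eq
  have hmem : m + 1 ∈ ∑ i, (w.word i : Multiset ℕ) := by
    rw [h, Icc_val_succ]; simp
  obtain ⟨i, -, hi⟩ := Multiset.mem_sum.mp hmem
  obtain ⟨a, b, hab⟩ := List.append_of_mem (Multiset.mem_coe.mp hi)
  have hs : (a : Multiset ℕ) + b + ∑ j, (Function.update w.word i [] j : Multiset ℕ) =
        (Finset.Icc 1 m).val := by
    have := add_sum_update w.word i []
    rw [h, Icc_val_succ, hab, ← Multiset.coe_add, ← Multiset.cons_coe] at this
    apply (Multiset.cons_inj_right (m + 1)).mp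
    rw [Multiset.coe_nil, zero_add] at this
    rw [← this]
    simp only [← Multiset.singleton_add]
    abel
  have hmem : ∀ x, x ∈ (a : Multiset ℕ) + b → x < m + 1 := by
    intro x hx
    have : x ∈ (Finset.Icc 1 m).val := by
      rw [← hs]; exact Multiset.mem_add.mpr (Or.inl hx)
    have := (Finset.mem_Icc.mp (by simpa using this)).2
    omega
  exact ⟨i, a, b, hab, fun x hx => hmem x (by simp [hx]), fun x hx => hmem x (by simp [hx]), hs⟩

/-- Append the largest letter `m + 1`, odd, to one of the words. -/
def appendOdd [DecidableEq ι] {m : ℕ} (hm : Odd (m + 1)) (p : ι × WordFamily ι m) :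
    WordFamily ι (m + 1) :=
  ⟨Function.update p.2.word p.1 (p.2.word p.1 ++ [m + 1]), by
    obtain ⟨i, w⟩ := p
    intro j
    rcases eq_or_ne j i with rfl | hj
    · rw [Function.update_self]
      exact (isEvenOddWord_append_cons_iff_of_odd hm (fun x hx => w.lt_succ hx)
        (by simp)).mpr ⟨rfl, w.isEvenOddWord j⟩
    · rw [Function.update_of_ne hj]; exact w.isEvenOddWord j, by
    obtain ⟨i, w⟩ := p
    have := add_sum_update w.word i (w.word i ++ [m + 1])
    rw [← Multiset.coe_add, add_assoc, add_right_inj, w.sum_eq] at this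
    rw [this, Icc_val_succ]; rfl⟩

theorem appendOdd_bijective [DecidableEq ι] {m : ℕ} (hm : Odd (m + 1)) :
    Function.Bijective (appendOdd (ι := ι) hm) := by
  constructor
  · rintro ⟨i, w⟩ ⟨i', w'⟩ h
    have h : Function.update w.word i (w.word i ++ [m + 1]) =
      Function.update w'.word i' (w'.word i' ++ [m + 1]) := congrArg WordFamily.word h
    have hi : i = i' := by
      by_contra hne
      have h1 := congrFun h i
      rw [Function.update_self, Function.update_of_ne hne] at h1
      have : m + 1 ∈ w'.word i := by rw [← h1]; simp
      exact (w'.lt_succ this).false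
    subst hi
    refine Prod.ext rfl (WordFamily.ext (funext fun j => ?_))
    have h1 := congrFun h j
    rcases eq_or_ne j i with rfl | hj
    · rw [Function.update_self, Function.update_self] at h1
      exact List.append_cancel_right h1
    · rwa [Function.update_of_ne hj, Function.update_of_ne hj] at h1
  · intro w
    obtain ⟨i, a, b, hab, ha, hb, hs⟩ := w.exists_eq_append_cons
    have hw := w.isEvenOddWord i
    rw [hab, isEvenOddWord_append_cons_iff_of_odd hm ha hb] at hw
    obtain ⟨rfl, hw⟩ := hw
    refine ⟨⟨i, ⟨Function.update w.word i a, fun j => ?_, ?_⟩⟩, ?_⟩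
    · rcases eq_or_ne j i with rfl | hj
      · rwa [Function.update_self]
      · rw [Function.update_of_ne hj]; exact w.isEvenOddWord j
    · have := add_sum_update (Function.update w.word i []) i a
      rw [Function.update_self, Function.update_idem] at this
      rw [← hs]
      simpa using this
    · refine WordFamily.ext (funext fun j => ?_)
      simp only [appendOdd, Function.update_idem, Function.update_self]
      rw [← hab, Function.update_eq_self]

/-- Join a nonempty extra word and one of the words by the largest letter `m + 1`, even. -/
def joinEven [DecidableEq ι] {m : ℕ} (hm : Even (m + 1))
    (p : ι × {w : WordFamily (Option ι) m // w.word none ≠ []}) : WordFamily ι (m + 1) :=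
  ⟨Function.update (fun j => p.2.val.word (some j)) p.1
      (p.2.val.word none ++ (m + 1) :: p.2.val.word (some p.1)), by
    obtain ⟨i, w, hw⟩ := p
    intro j
    rcases eq_or_ne j i with rfl | hj
    · rw [Function.update_self]
      exact (isEvenOddWord_append_cons_iff hm (fun x hx => w.lt_succ hx)
        (fun x hx => w.lt_succ hx)).mpr ⟨hw, w.isEvenOddWord _, w.isEvenOddWord _⟩
    · rw [Function.update_of_ne hj]; exact w.isEvenOddWord _, by
    obtain ⟨i, w, hw⟩ := p
    have := add_sum_update (fun j => w.word (some j)) i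
      (w.word none ++ (m + 1) :: w.word (some i))
    have h2 := w.sum_eq
    rw [Fintype.sum_option] at h2
    rw [Icc_val_succ, ← h2]
    rw [← Multiset.coe_add, ← Multiset.cons_coe] at this
    apply add_left_cancel (a := (w.word (some i) : Multiset ℕ))
    rw [this]
    simp only [← Multiset.singleton_add]
    abel⟩

theorem joinEven_bijective [DecidableEq ι] {m : ℕ} (hm : Even (m + 1)) :
    Function.Bijective (joinEven (ι := ι) hm) := by
  constructor
  · rintro ⟨i, w, hw⟩ ⟨i', w', hw'⟩ h
    have h : Function.update (fun j => w.word (some j)) i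
        (w.word none ++ (m + 1) :: w.word (some i)) =
      Function.update (fun j => w'.word (some j)) i'
        (w'.word none ++ (m + 1) :: w'.word (some i')) := congrArg WordFamily.word h
    have hi : i = i' := by
      by_contra hne
      have h1 := congrFun h i
      rw [Function.update_self, Function.update_of_ne hne] at h1
      have : m + 1 ∈ w'.word (some i) := by rw [← h1]; simp
      exact (w'.lt_succ this).false
    subst hi
    have h0 := congrFun h i
    rw [Function.update_self, Function.update_self] at h0
    obtain ⟨h1, h2⟩ := (List.append_cons_inj_of_notMem (fun hx => (w.lt_succ hx).false)
      (fun hx => (w.lt_succ hx).false)).mp h0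
    refine Prod.ext rfl (Subtype.ext (WordFamily.ext (funext fun j => ?_)))
    rcases j with _ | j
    · exact h1
    · rcases eq_or_ne j i with rfl | hj
      · exact h2.2
      · have h3 := congrFun h j
        rwa [Function.update_of_ne hj, Function.update_of_ne hj] at h3
  · intro w
    obtain ⟨i, a, b, hab, ha, hb, hs⟩ := w.exists_eq_append_cons
    have hw := w.isEvenOddWord i
    rw [hab, isEvenOddWord_append_cons_iff hm ha hb] at hw
    obtain ⟨hne, hwa, hwb⟩ := hw
    refine ⟨⟨i, ⟨⟨fun j => j.elim a (Function.update w.word i b), fun j => ?_, ?_⟩, hne⟩⟩, ?_⟩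
    · rcases j with _ | j
      · exact hwa
      · change IsEvenOddWord (Function.update w.word i b j)
        rcases eq_or_ne j i with rfl | hj
        · rwa [Function.update_self]
        · rw [Function.update_of_ne hj]; exact w.isEvenOddWord j
    · have := add_sum_update (Function.update w.word i []) i b
      rw [Function.update_self, Function.update_idem] at this
      rw [← hs, Fintype.sum_option, add_assoc, ← this]
      simp
    · refine WordFamily.ext (funext fun j => ?_)
      simp only [joinEven, Option.elim]
      rw [Function.update_self, ← hab, Function.update_idem, Function.update_eq_self]

/-- Families whose extra word is empty are families without the extra word. -/
def emptyNoneEquiv (ι : Type) [Fintype ι] (m : ℕ) :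
    {w : WordFamily (Option ι) m // ¬ w.word none ≠ []} ≃ WordFamily ι m where
  toFun w := ⟨fun j => w.val.word (some j), fun j => w.val.isEvenOddWord _, by
    have h := w.val.sum_eq
    rwa [Fintype.sum_option, not_not.mp w.2, Multiset.coe_nil, zero_add] at h⟩
  invFun w := ⟨⟨fun j => j.elim [] w.word, by
    rintro (_ | j)
    · exact ⟨List.isChain_nil, by simp⟩
    · exact w.isEvenOddWord j, by
    rw [Fintype.sum_option]; simpa using w.sum_eq⟩, by simp⟩
  left_inv w := by
    refine Subtype.ext (WordFamily.ext (funext fun j => ?_))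
    rcases j with _ | j
    · exact (not_not.mp w.2).symm
    · rfl
  right_inv w := rfl

/-- Relabelling the index set. -/
def WordFamily.congr {ι κ : Type} [Fintype ι] [Fintype κ] (e : ι ≃ κ) (m : ℕ) :
    WordFamily ι m ≃ WordFamily κ m where
  toFun w := ⟨fun k => w.word (e.symm k), fun k => w.isEvenOddWord _,
    (e.symm.sum_comp fun i => (w.word i : Multiset ℕ)).trans w.sum_eq⟩
  invFun w := ⟨fun i => w.word (e i), fun i => w.isEvenOddWord _,
    (e.sum_comp fun k => (w.word k : Multiset ℕ)).trans w.sum_eq⟩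
  left_inv w := by simp
  right_inv w := by simp

instance : Unique (WordFamily ι 0) where
  default := ⟨fun _ => [], fun _ => ⟨List.isChain_nil, by simp⟩, by simp⟩
  uniq w := WordFamily.ext (funext fun i => List.eq_nil_iff_forall_not_mem.mpr fun x hx => by
    have h := w.sum_eq
    have : x ∈ (Finset.Icc 1 0).val := by
      rw [← h]; exact Multiset.mem_sum.mpr ⟨i, Finset.mem_univ i, by simpa using hx⟩
    simp at this)

end families

/-! ### Counting families -/

theorem WordFamily.finite (m : ℕ) : ∀ (ι : Type) [Fintype ι], Finite (WordFamily ι m) := by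
  classical
  induction m with
  | zero => intro ι _; infer_instance
  | succ m ih =>
    intro ι _
    rcases Nat.even_or_odd (m + 1) with hm | hm
    · have := ih (Option ι)
      exact Finite.of_surjective _ (joinEven_bijective hm).2
    · have := ih ι
      exact Finite.of_surjective _ (appendOdd_bijective hm).2

theorem card_wordFamily_of_odd {m : ℕ} (hm : Odd (m + 1)) (y : ℕ) :
    Nat.card (WordFamily (Fin y) (m + 1)) = y * Nat.card (WordFamily (Fin y) m) := by
  rw [← Nat.card_congr (Equiv.ofBijective _ (appendOdd_bijective hm)), Nat.card_prod]
  simp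

/-- The difference counts families of y + 1 words whose extra word is nonempty; those with it empty
are families of y words. -/
theorem card_wordFamily_of_even {m : ℕ} (hm : Even (m + 1)) (y : ℕ) :
    (Nat.card (WordFamily (Fin y) (m + 1)) : ℤ) =
      y * (Nat.card (WordFamily (Fin (y + 1)) m) - Nat.card (WordFamily (Fin y) m)) := by
  classical
  have := WordFamily.finite m (Option (Fin y))
  rw [← Nat.card_congr (Equiv.ofBijective _ (joinEven_bijective hm)), Nat.card_prod,
    Nat.card_congr (WordFamily.congr finSuccEquivLast m),
    ← Nat.card_congr (Equiv.sumCompl fun w : WordFamily (Option (Fin y)) m => w.word none ≠ []),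
    Nat.card_sum, Nat.card_congr (emptyNoneEquiv (Fin y) m)]
  simp

theorem card_wordFamily_eq_gandhi (n y : ℕ) :
    (Nat.card (WordFamily (Fin y) (2 * n + 1)) : ℤ) = gandhi n y := by
  induction n generalizing y with
  | zero => simp [card_wordFamily_of_odd (m := 0), gandhi]
  | succ n ih =>
    rw [show 2 * (n + 1) + 1 = (2 * n + 1 + 1) + 1 by ring,
      card_wordFamily_of_odd ⟨n + 1, by ring⟩, Nat.cast_mul,
      card_wordFamily_of_even ⟨n + 1, by ring⟩, ih, ih, gandhi]
    ring

/-! ### From cycles to words -/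

theorem forall_next_iff_chain {α : Type*} [DecidableEq α] (r : α → α → Prop) {c : Cycle α}
    (hc : c.Nodup) : (∀ x (h : x ∈ c), r x (c.next hc x h)) ↔ c.Chain r := by
  induction c using Quotient.inductionOn' with
  | h l =>
    change (∀ x (h : x ∈ l), r x (l.next x h)) ↔ Cycle.Chain r (l : Cycle α)
    have hl : l.Nodup := hc
    cases l with
    | nil => simp
    | cons a l =>
      rw [Cycle.chain_coe_cons, List.isChain_iff_getElem]
      constructor
      · intro h i hi
        have hi' : i < (a :: l).length := by simpa using hi
        have := h _ (List.getElem_mem hi')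
        rw [List.next_getElem _ hl] at this
        simp only [← List.cons_append]
        rw [List.getElem_append_left hi']
        rcases Nat.lt_or_ge (i + 1) (a :: l).length with h1 | h1
        · rw [List.getElem_append_left h1]
          simpa only [Nat.mod_eq_of_lt h1] using this
        · have h2 : i + 1 = (a :: l).length := by omega
          rw [List.getElem_append_right h1]
          simpa [h2] using this
      · intro h x hx
        obtain ⟨i, hi, rfl⟩ := List.getElem_of_mem hx
        rw [List.next_getElem _ hl]
        have := h i (by simpa using hi)
        simp only [← List.cons_append] at this
        rw [List.getElem_append_left hi] at this
        rcases Nat.lt_or_ge (i + 1) (a :: l).length with h1 | h1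
        · rw [List.getElem_append_left h1] at this
          simpa only [Nat.mod_eq_of_lt h1] using this
        · have h2 : i + 1 = (a :: l).length := by omega
          rw [List.getElem_append_right h1] at this
          simpa [h2] using this

theorem CycleOn.onlyEvenOddDrops_iff_chain {N : ℕ} (c : CycleOn N) :
    c.OnlyEvenOddDrops ↔ c.val.Chain EvenOddStep := by
  rw [← forall_next_iff_chain _ c.2.1]
  constructor
  · intro h x hx hlt
    exact h (x, _) ⟨hx, rfl, hlt⟩
  · rintro h ⟨a, b⟩ ⟨ha, hb, hab⟩
    have := h a ha
    rw [hb] at this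
    exact this hab

/-- The drop out of `M` forces an odd start, and the return to `M` is a rise. -/
theorem chain_coe_cons_evenOddStep_iff {M : ℕ} (hM : Even M) {l : List ℕ}
    (hl : ∀ x ∈ l, x < M) :
    Cycle.Chain EvenOddStep ((M :: l : List ℕ) : Cycle ℕ) ↔ IsEvenOddWord l := by
  rw [Cycle.chain_coe_cons, List.isChain_cons, List.isChain_append, IsEvenOddWord]
  constructor
  · rintro ⟨h1, h2, -⟩
    refine ⟨h2, fun x hx => ?_⟩
    cases l with
    | nil => simp at hx
    | cons a l => exact (h1 x (by simpa using hx) (hl x (List.mem_of_mem_head? hx))).2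
  · rintro ⟨h1, h2⟩
    refine ⟨fun x hx => ?_, h1, by simp, fun x hx y hy => ?_⟩
    · cases l with
      | nil =>
        have : M = x := by simpa using hx
        exact fun h => absurd h (by omega)
      | cons a l => exact .of_even_odd hM (h2 x (by simpa using hx))
    · have : M = y := by simpa using hy
      exact .of_lt (this ▸ hl x (List.mem_of_mem_getLast? hx))

theorem coe_eq_Icc_val_iff {l : List ℕ} {m : ℕ} :
    (l : Multiset ℕ) = (Finset.Icc 1 m).val ↔ l.Nodup ∧ ∀ k, k ∈ l ↔ 1 ≤ k ∧ k ≤ m := by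
  constructor
  · intro h
    refine ⟨by rw [← Multiset.coe_nodup, h]; exact Finset.nodup _, fun k => ?_⟩
    rw [← Multiset.mem_coe, h, Finset.mem_val, Finset.mem_Icc]
  · rintro ⟨h1, h2⟩
    refine (Multiset.Nodup.ext (Multiset.coe_nodup.mpr h1) (Finset.nodup _)).mpr fun k => ?_
    rw [Multiset.mem_coe, h2, Finset.mem_val, Finset.mem_Icc]

/-- Close up a single word by the largest letter `m + 1`, even, to a cycle. -/
def closeUp {m : ℕ} (hm : Even (m + 1)) (w : WordFamily (Fin 1) m) :
    {c : CycleOn (m + 1) // c.OnlyEvenOddDrops} :=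
  ⟨⟨((m + 1) :: w.word 0 : List ℕ), by
    have h := w.sum_eq
    rw [Fin.sum_univ_one] at h
    have h' : (((m + 1) :: w.word 0 : List ℕ) : Multiset ℕ) = (Finset.Icc 1 (m + 1)).val := by
      rw [Icc_val_succ, ← h]; rfl
    simpa only [Cycle.nodup_coe_iff, Cycle.mem_coe_iff] using coe_eq_Icc_val_iff.mp h'⟩,
    (CycleOn.onlyEvenOddDrops_iff_chain _).mpr
      ((chain_coe_cons_evenOddStep_iff hm fun _ hx => w.lt_succ hx).mpr (w.isEvenOddWord 0))⟩

theorem closeUp_bijective {m : ℕ} (hm : Even (m + 1)) : Function.Bijective (closeUp hm) := by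
  constructor
  · intro w w' h
    have h1 : (((m + 1) :: w.word 0 : List ℕ) : Cycle ℕ) = ((m + 1) :: w'.word 0 : List ℕ) :=
      congrArg (fun c => c.val.val) h
    obtain ⟨k, hk⟩ : ((m + 1) :: w.word 0) ~r ((m + 1) :: w'.word 0) := Cycle.coe_eq_coe.mp h1
    have h0 : w.word 0 = w'.word 0 := by
      rw [← List.rotate_mod] at hk
      have hlt : k % ((m + 1) :: w.word 0).length < ((m + 1) :: w.word 0).length :=
        Nat.mod_lt _ (by simp)
      generalize k % ((m + 1) :: w.word 0).length = j at hk hlt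
      rw [List.rotate_eq_drop_append_take hlt.le] at hk
      -- A nontrivial rotation would put a letter at most `m` first, where `m + 1` must stand.
      cases j with
      | zero => simpa using hk
      | succ j =>
        exfalso
        have hj : j < (w.word 0).length := by simpa using hlt
        rw [List.drop_succ_cons, List.drop_eq_getElem_cons hj, List.cons_append,
          List.cons.injEq] at hk
        exact (w.lt_succ (List.getElem_mem hj)).ne hk.1
    refine WordFamily.ext (funext fun j => ?_)
    rwa [Subsingleton.elim j 0]
  · rintro ⟨⟨c, hc⟩, hd⟩
    have hch : c.Chain EvenOddStep := (CycleOn.onlyEvenOddDrops_iff_chain _).mp hd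
    induction c using Quotient.inductionOn' with
    | h l =>
      have hmem : m + 1 ∈ l := (hc.2 (m + 1)).mpr ⟨by omega, le_rfl⟩
      obtain ⟨a, b, rfl⟩ := List.append_of_mem hmem
      have he : ((a ++ (m + 1) :: b : List ℕ) : Cycle ℕ) = ((m + 1) :: (b ++ a) : List ℕ) :=
        Cycle.coe_eq_coe.mpr ⟨a.length, by simp⟩
      change ((a ++ (m + 1) :: b : List ℕ) : Cycle ℕ).Nodup ∧ (∀ k : ℕ,
        k ∈ ((a ++ (m + 1) :: b : List ℕ) : Cycle ℕ) ↔ _) at hc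
      change Cycle.Chain EvenOddStep ((a ++ (m + 1) :: b : List ℕ) : Cycle ℕ) at hch
      rw [he] at hc hch
      simp only [Cycle.nodup_coe_iff, Cycle.mem_coe_iff] at hc
      have hs := coe_eq_Icc_val_iff.mpr hc
      rw [Icc_val_succ, ← Multiset.cons_coe, Multiset.cons_inj_right] at hs
      have hlt : ∀ x ∈ b ++ a, x < m + 1 := fun x hx =>
        Nat.lt_succ_of_le ((coe_eq_Icc_val_iff.mp hs).2 x |>.mp hx).2
      refine ⟨⟨fun _ => b ++ a, fun _ => (chain_coe_cons_evenOddStep_iff hm hlt).mp hch,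
        by rw [Fin.sum_univ_one]; exact hs⟩, ?_⟩
      exact Subtype.ext (Subtype.ext he.symm)

theorem mainTheorem3 (n : ℕ) (hn : 1 ≤ n) :
    genocchi n = (Nat.card {c : CycleOn (2 * n) // c.OnlyEvenOddDrops} : ℚ) := by
  obtain ⟨n, rfl⟩ := Nat.exists_eq_add_of_le' hn
  have hm : Even (2 * n + 1 + 1) := ⟨n + 1, by ring⟩
  rw [genocchi_succ_eq_gandhi, ← card_wordFamily_eq_gandhi,
    Nat.card_congr (Equiv.ofBijective _ (closeUp_bijective hm)), Int.cast_natCast]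
  rfl
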